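/- Let $A\in\mathbb{Z}^{m\times n}$ have rank $m$ and let $\mathbf c\in\mathbb{Q}^n$ satisfy $\mathbf c^\intercal\mathbf x\le 0$ for all $\mathbf x\in\mathbb{R}^n_{\ge0}$ with $A\mathbf x=\mathbf 0$. For $\mathbf b\in\mathbb{Z}^m$ let $\operatorname{IP}(\mathbf b)$ be the integer program $\max\{\mathbf c^\intercal\mathbf z: A\mathbf z=\mathbf b,\ \mathbf z\in\mathbb{Z}^n_{\ge0}\}$ and $\operatorname{LP}(\mathbf b)$ the linear program $\max\{\mathbf c^\intercal\mathbf x: A\mathbf x=\mathbf b,\ \mathbf x\in\mathbb{R}^n_{\ge0}\}$. Assume that for every $\mathbf b\in\mathbb{Z}^m$ for which $\operatorname{LP}(\mathbf b)$ is feasible, $\operatorname{LP}(\mathbf b)$ has a unique optimal solution $\mathbf x^*(\mathbf b)$. Define the IP-to-LP distance function $$\pi(\mathbf b):=\min\{\|\mathbf x^*(\mathbf b)-\mathbf z^*\|_1:\ \mathbf z^*\text{ is an optimal solution to }\operatorname{IP}(\mathbf b)\},$$ with $\pi(\mathbf b):=\infty$ if $\operatorname{IP}(\mathbf b)$ is infeasible.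 For $\alpha\ge 0$ let $$\Pr(\pi\le\alpha):=\liminf_{t\to\infty}\frac{|\{\mathbf b\in\mathbb{Z}^m:\ \pi(\mathbf b)\le\alpha,\ \|\mathbf b\|_\infty\le t,\ \pi(\mathbf b)<\infty\}|}{|\{\mathbf b\in\mathbb{Z}^m:\ \|\mathbf b\|_\infty\le t,\ \pi(\mathbf b)<\infty\}|},$$ where $t$ ranges over the positive integers, and let $\|A\|_\infty$ denote the largest absolute value of an entry of $A$. Then $$\Pr\left(\pi\le (m+1)\left(\sqrt m\,\|A\|_\infty\right)^m\right)=1.$$ -/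

import Mathlib

open scoped ENNReal Matrix

namespace ParametricIP

noncomputable section

/-- The integer matrix `A`, viewed as a real matrix. -/
def realMatrix {m n : ℕ} (A : Matrix (Fin m) (Fin n) ℤ) : Matrix (Fin m) (Fin n) ℝ :=
  A.map (fun a : ℤ => (a : ℝ))

/-- The linear objective value `cᵀ x`. -/
def objective {n : ℕ} (c : Fin n → ℚ) (x : Fin n → ℝ) : ℝ :=
  ∑ j, (c j : ℝ) * x j

/-- `x` is feasible for `LP(b)`: `A x = b` and `x ≥ 0`. -/
def LPFeasible {m n : ℕ} (A : Matrix (Fin m) (Fin n) ℤ) (b : Fin m → ℤ)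
    (x : Fin n → ℝ) : Prop :=
  (realMatrix A *ᵥ x = fun i => (b i : ℝ)) ∧ ∀ j, 0 ≤ x j

/-- `x` is an optimal solution of `LP(b)`: `max {cᵀ x : A x = b, x ≥ 0}`. -/
def LPOptimal {m n : ℕ} (A : Matrix (Fin m) (Fin n) ℤ) (c : Fin n → ℚ) (b : Fin m → ℤ)
    (x : Fin n → ℝ) : Prop :=
  LPFeasible A b x ∧ ∀ y, LPFeasible A b y → objective c y ≤ objective c x

/-- `z` is feasible for `IP(b)`: `A z = b`, with `z ≥ 0` integral. -/
def IPFeasible {m n : ℕ} (A : Matrix (Fin m) (Fin n) ℤ) (b : Fin m → ℤ)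
    (z : Fin n → ℤ) : Prop :=
  A *ᵥ z = b ∧ ∀ j, 0 ≤ z j

/-- `z` is an optimal solution of `IP(b)`: `max {cᵀ z : A z = b, z ≥ 0 integral}`. -/
def IPOptimal {m n : ℕ} (A : Matrix (Fin m) (Fin n) ℤ) (c : Fin n → ℚ) (b : Fin m → ℤ)
    (z : Fin n → ℤ) : Prop :=
  IPFeasible A b z ∧ ∀ y, IPFeasible A b y →
    objective c (fun j => (y j : ℝ)) ≤ objective c (fun j => (z j : ℝ))

/-- `x*(b)`: the optimal solution of `LP(b)`
(meaningful when `LP(b)` has exactly one optimal solution). -/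
def lpSolution {m n : ℕ} (A : Matrix (Fin m) (Fin n) ℤ) (c : Fin n → ℚ) (b : Fin m → ℤ) :
    Fin n → ℝ :=
  Classical.epsilon (LPOptimal A c b)

/-- The distance function
`π(b) = min {‖x*(b) - z‖₁ : z an optimal solution of IP(b)}`, with values in `[0, ∞]`.
The infimum over the empty set is `∞`, so `π(b) = ∞` when `IP(b)` is infeasible; over a nonempty
set the infimum is attained, because only finitely many integer points lie within a given
distance of `x*(b)`. -/
def distFun {m n : ℕ} (A : Matrix (Fin m) (Fin n) ℤ) (c : Fin n → ℚ) (b : Fin m → ℤ) : ℝ≥0∞ :=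
  ⨅ (z : Fin n → ℤ) (_ : IPOptimal A c b z),
    ENNReal.ofReal (∑ j, |lpSolution A c b j - (z j : ℝ)|)

/-- `Pr_t(E)`: the proportion of elements of `E` among the `b ∈ ℤ^m` with `‖b‖_∞ ≤ t` and
`f(b) < ∞`. -/
def boxDensity {m : ℕ} (f : (Fin m → ℤ) → ℝ≥0∞) (E : Set (Fin m → ℤ)) (t : ℕ) : ℝ :=
  (Set.ncard {b : Fin m → ℤ | b ∈ E ∧ (∀ i, |b i| ≤ (t : ℤ)) ∧ f b < ∞} : ℝ) /
    (Set.ncard {b : Fin m → ℤ | (∀ i, |b i| ≤ (t : ℤ)) ∧ f b < ∞} : ℝ)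

/-- The lower asymptotic density `Pr(E) = liminf_{t → ∞} Pr_t(E)`. -/
def lowerDensity {m : ℕ} (f : (Fin m → ℤ) → ℝ≥0∞) (E : Set (Fin m → ℤ)) : ℝ :=
  Filter.liminf (boxDensity f E) Filter.atTop

/-- `Pr(f ≤ α)` for real `α ≥ 0`. -/
def prLe {m : ℕ} (f : (Fin m → ℤ) → ℝ≥0∞) (α : ℝ) : ℝ :=
  lowerDensity f {b | f b ≤ ENNReal.ofReal α}

/-- `‖A‖_∞`: the largest absolute value of an entry of `A`. -/
def maxAbsEntry {m n : ℕ} (A : Matrix (Fin m) (Fin n) ℤ) : ℕ :=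
  Finset.univ.sup (fun p : Fin m × Fin n => (A p.1 p.2).natAbs)

end

end ParametricIP

/-! Let `H = (√m ‖A‖_∞)^m`. By Hadamard's inequality `H` bounds every `m × m` minor of `A`, hence
also, by Cramer's rule, every entry of `det(A_B) A_B⁻¹ A`. Uniqueness makes `x*(b)` a vertex,
supported on some basis `B`. If `b` is far from the facets of the cone of `A_B`, the vertex is
nondegenerate and the reduced costs have the optimal sign. Take any feasible integer `y`. Modulo the
lattice `A_B ℤ^m`, of index `|det A_B|`, pigeonhole on partial sums shortens the nonbasic part of
`y` to fewer than `|det A_B|` units. Re-solving for the basic variables gives an integer point,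
nonnegative because `b` is deep and no worse because of the reduced costs
(`exists_ipFeasible_sum_lt`). So some IP optimum has a small nonbasic part; each basic coordinate
then moves by at most `H`, and the nonbasic part contributes at most `H`, which gives `(m + 1) H`
(`sum_abs_sub_le`). The remaining `b` lie in finitely many slabs, with `O(t^(m-1))` points in the
cube of radius `t` when `m > 0`, while the feasible `b` number at least a constant times `t^m`. The
exceptions therefore have density zero. -/

namespace ParametricIP

open Finset

/-! ### Determinant bounds -/

/-- Hadamard's inequality for the columns of a real square matrix. -/
theorem abs_det_le_prod_norm_col {m : ℕ} (M : Matrix (Fin m) (Fin m) ℝ) :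
    |M.det| ≤ ∏ j, ‖WithLp.toLp 2 (M.col j)‖ := by
  let e := EuclideanSpace.basisFun (Fin m) ℝ
  have : Fact (Module.finrank ℝ (EuclideanSpace ℝ (Fin m)) = m) := ⟨by simp⟩
  have h := (e.toBasis.orientation).abs_volumeForm_apply_le (fun j => WithLp.toLp 2 (M.col j))
  rw [Orientation.volumeForm_robust _ e rfl] at h
  rw [Module.Basis.det_apply] at h
  convert h using 3
  ext i j
  simp [e, Module.Basis.toMatrix_apply]

/-- A square integer matrix with entries of absolute value at most `k` has determinant at most
`(√m k)^m` in absolute value. -/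
theorem abs_det_le_of_abs_le {m : ℕ} (M : Matrix (Fin m) (Fin m) ℤ) {k : ℕ}
    (h : ∀ i j, |M i j| ≤ (k : ℤ)) : |(M.det : ℝ)| ≤ (Real.sqrt m * k) ^ m := by
  have h1 := abs_det_le_prod_norm_col (M.map (fun a : ℤ => (a : ℝ)))
  have h2 : (M.map (fun a : ℤ => (a : ℝ))).det = (M.det : ℝ) := (Int.cast_det M).symm
  rw [h2] at h1
  refine h1.trans ?_
  calc _ ≤ ∏ _j : Fin m, (Real.sqrt m * k) := by
        refine prod_le_prod (fun _ _ => norm_nonneg _) fun j _ => ?_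
        rw [EuclideanSpace.norm_eq]
        apply Real.sqrt_le_iff.2 ⟨by positivity, ?_⟩
        rw [mul_pow, Real.sq_sqrt (Nat.cast_nonneg _)]
        calc _ ≤ ∑ _i : Fin m, (k : ℝ) ^ 2 := by
              refine sum_le_sum fun i _ => ?_
              have h3 : |(M i j : ℝ)| ≤ k := by exact_mod_cast h i j
              simpa using pow_le_pow_left₀ (abs_nonneg _) h3 2
          _ = _ := by simp
    _ = _ := by simp

/-! ### Zero-sum subfamilies and lattice quotients -/

/-- Adding one unit at a time gives a chain up to `u`. It encodes the initial segments of a list in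
which `j` occurs `u j` times, the input for the pigeonhole argument on partial sums. -/
theorem exists_monotone_sum_eq {ι : Type*} [Fintype ι] [DecidableEq ι] (u : ι → ℕ) :
    ∃ p : ℕ → ι → ℕ, Monotone p ∧ (∀ k, p k ≤ u) ∧ ∀ k ≤ ∑ j, u j, ∑ j, p k j = k := by
  induction hs : ∑ j, u j generalizing u with
  | zero => exact ⟨fun _ => u, monotone_const, fun _ => le_rfl, fun k hk => by simp_all⟩
  | succ s ih =>
    obtain ⟨j, -, hj⟩ : ∃ j ∈ univ, u j ≠ 0 := exists_ne_zero_of_sum_ne_zero (by omega)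
    have hu : u = (u - Pi.single j 1) + Pi.single j 1 := by
      ext i
      by_cases hi : i = j
      · subst hi; simp; omega
      · simp [hi]
    obtain ⟨p, hp, hpu, hps⟩ := ih (u - Pi.single j 1) (by
      rw [hu] at hs
      simpa [sum_add_distrib] using hs)
    have hle : ∀ k, p k ≤ u := fun k => (hpu k).trans tsub_le_self
    refine ⟨fun k => if k ≤ s then p k else u, ?_, ?_, ?_⟩
    · intro a b hab
      dsimp only
      split_ifs
      · exact hp hab
      · exact hle a
      · omega
      · exact le_rfl
    · intro k
      dsimp only
      split_ifs
      exacts [hle k, le_rfl]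
    · intro k hk
      dsimp only
      split_ifs with h
      · exact hps k h
      · omega

/-- In a finite abelian group, a family with at least `|G|` terms has a nonempty zero-sum
subfamily. -/
theorem exists_zero_sum_le {ι G : Type*} [Fintype ι] [AddCommGroup G] [Finite G]
    (g : ι → G) (u : ι → ℕ) (hu : Nat.card G ≤ ∑ j, u j) :
    ∃ w ≤ u, w ≠ 0 ∧ ∑ j, w j • g j = 0 := by
  classical
  have := Fintype.ofFinite G
  obtain ⟨p, hp, hpu, hps⟩ := exists_monotone_sum_eq u
  -- The chain has `|G| + 1` partial sums, the empty one included, so two coincide; their difference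
  -- is the zero-sum subfamily.
  obtain ⟨a, b, hab, h⟩ := Fintype.exists_ne_map_eq_of_card_lt
    (fun a : Fin (Nat.card G + 1) => ∑ j, p a j • g j) (by simp)
  wlog hlt : a < b generalizing a b
  · exact this b a hab.symm h.symm (lt_of_le_of_ne (not_lt.1 hlt) hab.symm)
  have hle : p a ≤ p b := hp hlt.le
  refine ⟨p b - p a, tsub_le_self.trans (hpu b), ?_, ?_⟩
  · intro h0
    have h1 : p b ≤ p a := tsub_eq_zero_iff_le.1 h0
    have h2 := hps a (by omega)
    have h3 := hps b (by omega)
    rw [le_antisymm h1 hle] at h3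
    have : (a : ℕ) < b := hlt
    omega
  · have : ∑ j, (p b - p a) j • g j + ∑ j, p a j • g j = ∑ j, p b j • g j := by
      rw [← sum_add_distrib]
      refine sum_congr rfl fun j _ => ?_
      rw [← add_smul, Pi.sub_apply, Nat.sub_add_cancel (hle j)]
    simpa [h] using this

/-- As long as at least `|G|` terms remain, a nonempty zero-sum subfamily can be deleted without
changing the sum. -/
theorem exists_le_sum_lt_card {ι G : Type*} [Fintype ι] [AddCommGroup G] [Finite G]
    (g : ι → G) (y : ι → ℕ) :
    ∃ u ≤ y, ∑ j, u j < Nat.card G ∧ ∑ j, u j • g j = ∑ j, y j • g j := by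
  induction hs : ∑ j, y j using Nat.strong_induction_on generalizing y with
  | _ s ih =>
    by_cases hlt : ∑ j, y j < Nat.card G
    · exact ⟨y, le_rfl, hlt, rfl⟩
    obtain ⟨w, hw, hw0, hwg⟩ := exists_zero_sum_le g y (not_lt.1 hlt)
    have hadd : ∀ j, (y - w) j + w j = y j := fun j => Nat.sub_add_cancel (hw j)
    have h1 : ∑ j, (y - w) j + ∑ j, w j = ∑ j, y j := by
      rw [← sum_add_distrib]
      exact sum_congr rfl fun j _ => hadd j
    have h2 : 0 < ∑ j, w j := by
      obtain ⟨j, hj⟩ := Function.ne_iff.1 hw0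
      exact sum_pos' (fun _ _ => Nat.zero_le _) ⟨j, mem_univ j, Nat.pos_of_ne_zero hj⟩
    obtain ⟨u, hu, hus, hug⟩ := ih _ (by omega) (y - w) rfl
    refine ⟨u, hu.trans tsub_le_self, hus, hug.trans ?_⟩
    have h3 : ∑ j, (y - w) j • g j + ∑ j, w j • g j = ∑ j, y j • g j := by
      rw [← sum_add_distrib]
      exact sum_congr rfl fun j _ => by rw [← add_smul, hadd]
    rwa [hwg, add_zero] at h3

theorem card_quotient_range_mulVecLin {m : ℕ} (M : Matrix (Fin m) (Fin m) ℤ) (hM : M.det ≠ 0) :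
    Nat.card ((Fin m → ℤ) ⧸ LinearMap.range M.mulVecLin) = M.det.natAbs := by
  have hinj : Function.Injective M.mulVecLin :=
    Matrix.mulVec_injective_of_det_ne_zero hM
  rw [← Submodule.natAbs_det_equiv _ (LinearEquiv.ofInjective M.mulVecLin hinj)]
  have : (LinearMap.range M.mulVecLin).subtype ∘ₗ
      AddMonoidHom.toIntLinearMap ((LinearEquiv.ofInjective M.mulVecLin hinj :
        (Fin m → ℤ) ≃ₗ[ℤ] _) : (Fin m → ℤ) →+ _) = Matrix.toLin' M := by
    ext; simp
  rw [this, LinearMap.det_toLin']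

/-- Modulo the lattice generated by the columns of `M`, a nonnegative combination of vectors `a j`
may be shortened to one with fewer than `|det M|` terms. -/
theorem exists_le_sum_lt_natAbs_det {m : ℕ} {ι : Type*} [Fintype ι]
    (M : Matrix (Fin m) (Fin m) ℤ) (hM : M.det ≠ 0) (a : ι → Fin m → ℤ) (y : ι → ℕ) :
    ∃ u ≤ y, ∑ j, u j < M.det.natAbs ∧
      ∃ v : Fin m → ℤ, M *ᵥ v = ∑ j, y j • a j - ∑ j, u j • a j := by
  have hc := card_quotient_range_mulVecLin M hM
  have : Finite ((Fin m → ℤ) ⧸ LinearMap.range M.mulVecLin) :=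
    Nat.finite_of_card_ne_zero (by rw [hc]; exact Int.natAbs_ne_zero.2 hM)
  obtain ⟨u, hu, hs, hg⟩ := exists_le_sum_lt_card
    (fun j => (LinearMap.range M.mulVecLin).mkQ (a j)) y
  refine ⟨u, hu, hc ▸ hs, ?_⟩
  simp only [← map_nsmul, ← map_sum] at hg
  simpa using (Submodule.Quotient.eq _).1 hg.symm

/-! ### The simplex tableau without division -/

/-- The rescaled simplex tableau `det(A_B) A_B⁻¹ A` of the columns of `A` chosen by `B`. -/
def tableau {m n : ℕ} (A : Matrix (Fin m) (Fin n) ℤ) (B : Fin m → Fin n) :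
    Matrix (Fin m) (Fin n) ℤ :=
  (A.submatrix id B).adjugate * A

variable {m n : ℕ} {A : Matrix (Fin m) (Fin n) ℤ} {c : Fin n → ℚ} {b : Fin m → ℤ}
  {B : Fin m → Fin n}

theorem tableau_apply_basis (A : Matrix (Fin m) (Fin n) ℤ) (B : Fin m → Fin n) (i k : Fin m) :
    tableau A B i (B k) = if i = k then (A.submatrix id B).det else 0 := by
  have h := congrFun (congrFun (Matrix.adjugate_mul (A.submatrix id B)) i) k
  simpa [Matrix.mul_apply, tableau, Matrix.one_apply] using h

theorem sum_mul_tableau (A : Matrix (Fin m) (Fin n) ℤ) (B : Fin m → Fin n) (k : Fin m)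
    (j : Fin n) : ∑ i, A k (B i) * tableau A B i j = (A.submatrix id B).det * A k j := by
  have h : A.submatrix id B * tableau A B = (A.submatrix id B).det • A := by
    rw [tableau, ← Matrix.mul_assoc, Matrix.mul_adjugate, Matrix.smul_mul, Matrix.one_mul]
  simpa [Matrix.mul_apply] using congrFun (congrFun h k) j

theorem sum_tableau_mul (A : Matrix (Fin m) (Fin n) ℤ) (B : Fin m → Fin n) (x : Fin n → ℝ)
    (i : Fin m) : ∑ j, (tableau A B i j : ℝ) * x j =
      ∑ k, ((A.submatrix id B).adjugate i k : ℝ) * (realMatrix A *ᵥ x) k := by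
  have h : (tableau A B).map (fun a : ℤ => (a : ℝ)) *ᵥ x =
      (A.submatrix id B).adjugate.map (fun a : ℤ => (a : ℝ)) *ᵥ (realMatrix A *ᵥ x) := by
    have h2 : (tableau A B).map (fun a : ℤ => (a : ℝ)) =
        (A.submatrix id B).adjugate.map (fun a : ℤ => (a : ℝ)) * realMatrix A :=
      Matrix.map_mul (f := Int.castRingHom ℝ)
    rw [h2, Matrix.mulVec_mulVec]
  exact congrFun h i

/-- Multiply `A x = b` by the adjugate of `A_B`. If `x` vanishes off `B`, this reads `det(A_B) x_B =
adj(A_B) b`. -/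
theorem sum_tableau_mul_of_feasible {x : Fin n → ℝ} (hx : LPFeasible A b x) (B : Fin m → Fin n)
    (i : Fin m) : ∑ j, (tableau A B i j : ℝ) * x j =
      (((A.submatrix id B).adjugate *ᵥ b) i : ℤ) := by
  rw [sum_tableau_mul, hx.1]
  simp [Matrix.mulVec, dotProduct]

/-- Entries of the tableau are determinants of order `m`. -/
theorem abs_tableau_le (A : Matrix (Fin m) (Fin n) ℤ) (B : Fin m → Fin n) (i : Fin m)
    (j : Fin n) : |(tableau A B i j : ℝ)| ≤ (Real.sqrt m * maxAbsEntry A) ^ m := by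
  have hle : ∀ k l, |A k l| ≤ (maxAbsEntry A : ℤ) := fun k l => by
    rw [Int.abs_eq_natAbs]
    exact_mod_cast le_sup (f := fun p : Fin m × Fin n => (A p.1 p.2).natAbs) (mem_univ (k, l))
  -- Cramer's rule: replace column `i` of `A_B` by column `j` of `A`.
  have h : tableau A B i j = ((A.submatrix id B).updateCol i (A.col j)).det := by
    rw [← Matrix.cramer_apply, Matrix.cramer_eq_adjugate_mulVec]
    rfl
  rw [h]
  refine abs_det_le_of_abs_le _ fun k l => ?_
  rw [Matrix.updateCol_apply]
  split_ifs
  exacts [hle _ _, hle _ _]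

theorem abs_det_submatrix_le (A : Matrix (Fin m) (Fin n) ℤ) (B : Fin m → Fin n) :
    |((A.submatrix id B).det : ℝ)| ≤ (Real.sqrt m * maxAbsEntry A) ^ m := by
  refine abs_det_le_of_abs_le _ fun k l => ?_
  rw [Int.abs_eq_natAbs]
  exact_mod_cast le_sup (f := fun p : Fin m × Fin n => (A p.1 p.2).natAbs) (mem_univ (k, B l))

theorem injective_of_det_submatrix_ne_zero (h : (A.submatrix id B).det ≠ 0) :
    Function.Injective B := by
  intro i k hik
  by_contra hne
  exact h (Matrix.det_zero_of_column_eq hne fun l => by simp [hik])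

theorem sum_eq_sum_basis_add {M : Type*} [AddCommMonoid M] [DecidableEq (Fin n)]
    (hB : Function.Injective B) (f : Fin n → M) :
    ∑ j, f j = ∑ i, f (B i) + ∑ j ∈ (univ.image B)ᶜ, f j := by
  rw [← sum_add_sum_compl (univ.image B) f, sum_image fun _ _ _ _ h => hB h]

theorem mulVec_extend {R : Type*} [CommRing R] (M : Matrix (Fin m) (Fin n) R)
    (hB : Function.Injective B) (v : Fin m → R) :
    M *ᵥ Function.extend B v 0 = M.submatrix id B *ᵥ v := by
  ext k
  simp only [Matrix.mulVec, dotProduct]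
  rw [sum_eq_sum_basis_add hB, sum_eq_zero (s := (univ.image B)ᶜ), add_zero]
  · exact sum_congr rfl fun i _ => by rw [hB.extend_apply]; rfl
  · intro j hj
    rw [Function.extend_apply', Pi.zero_apply, mul_zero]
    simpa using hj

/-! ### Reduced costs and optimal bases -/

/-- Reduced costs of the columns of `A` with respect to `B`, multiplied by `det A_B`. -/
noncomputable def reducedCost (A : Matrix (Fin m) (Fin n) ℤ) (c : Fin n → ℚ)
    (B : Fin m → Fin n) (j : Fin n) : ℝ :=
  (A.submatrix id B).det * c j - ∑ i, (c (B i) : ℝ) * tableau A B i j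

theorem reducedCost_basis (A : Matrix (Fin m) (Fin n) ℤ) (c : Fin n → ℚ)
    (B : Fin m → Fin n) (k : Fin m) : reducedCost A c B (B k) = 0 := by
  simp [reducedCost, tableau_apply_basis, mul_comm]

/-- The vectors `det(A_B) c` and `reducedCost` differ by a combination of tableau rows, and these
vanish on the kernel of `A`. -/
theorem det_mul_objective_of_mulVec_eq_zero {g : Fin n → ℝ} (hg : realMatrix A *ᵥ g = 0)
    (c : Fin n → ℚ) (B : Fin m → Fin n) :
    (A.submatrix id B).det * objective c g = ∑ j, reducedCost A c B j * g j := by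
  have h : ∀ i, ∑ j, (tableau A B i j : ℝ) * g j = 0 := fun i => by
    rw [sum_tableau_mul, hg]; simp
  simp only [reducedCost, sub_mul, sum_sub_distrib, objective, mul_sum, sum_mul]
  rw [sum_comm (s := univ (α := Fin n)) (t := univ (α := Fin m))]
  simp only [mul_assoc, ← mul_sum, h]
  simp

theorem objective_add_smul (c : Fin n → ℚ) (x g : Fin n → ℝ) (ε : ℝ) :
    objective c (x + ε • g) = objective c x + ε * objective c g := by
  simp only [objective, mul_sum, ← sum_add_distrib]
  exact sum_congr rfl fun j _ => by simp; ring

theorem exists_pos_add_smul_nonneg {x w : Fin n → ℝ} (hx : ∀ j, 0 ≤ x j)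
    (hw : ∀ j, x j = 0 → 0 ≤ w j) : ∃ ε : ℝ, 0 < ε ∧ ∀ j, 0 ≤ (x + ε • w) j := by
  have h : ∀ᶠ ε : ℝ in nhdsWithin 0 (Set.Ioi 0), ∀ j, 0 ≤ (x + ε • w) j := by
    refine Filter.eventually_all.2 fun j => ?_
    rcases (hx j).eq_or_lt with h0 | h0
    · filter_upwards [self_mem_nhdsWithin] with ε hε
      simpa [← h0] using mul_nonneg (le_of_lt hε) (hw j h0.symm)
    · have ht : Filter.Tendsto (fun ε : ℝ => (x + ε • w) j) (nhds 0) (nhds (x j)) := by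
        have : Continuous fun ε : ℝ => (x + ε • w) j := by
          simp only [Pi.add_apply, Pi.smul_apply, smul_eq_mul]
          fun_prop
        simpa using this.tendsto 0
      exact nhdsWithin_le_nhds ((ht.eventually (lt_mem_nhds h0)).mono fun _ => le_of_lt)
  obtain ⟨ε, h1, h2⟩ := (h.and self_mem_nhdsWithin).exists
  exact ⟨ε, h2, h1⟩

/-- Feasible directions at an optimal solution do not increase the objective. -/
theorem LPOptimal.objective_nonpos {x w : Fin n → ℝ} (hx : LPOptimal A c b x)
    (hA : realMatrix A *ᵥ w = 0) (hw : ∀ j, x j = 0 → 0 ≤ w j) : objective c w ≤ 0 := by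
  obtain ⟨ε, hε, h⟩ := exists_pos_add_smul_nonneg hx.1.2 hw
  have h1 := hx.2 (x + ε • w)
    ⟨by rw [Matrix.mulVec_add, Matrix.mulVec_smul, hA, smul_zero, add_zero, hx.1.1], h⟩
  rw [objective_add_smul] at h1
  nlinarith

/-- A unique optimal solution is a basic solution. -/
theorem LPOptimal.linearIndepOn_col {x : Fin n → ℝ} (hx : LPOptimal A c b x)
    (huniq : ∀ y, LPOptimal A c b y → y = x) :
    LinearIndepOn ℝ (realMatrix A).col {j | x j ≠ 0} := by
  classical
  have hS : {j | x j ≠ 0} = ((univ.filter fun j => x j ≠ 0 : Finset (Fin n)) : Set (Fin n)) := by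
    ext; simp
  rw [hS, linearIndepOn_finset_iff]
  intro f hf
  -- The linear relation, extended by zero. Both `g` and `-g` are feasible directions, so the
  -- objective is constant along `g`; then `x + ε • g` is a second optimum unless `g = 0`.
  set g : Fin n → ℝ := fun j => if x j ≠ 0 then f j else 0 with hg
  have hAg : realMatrix A *ᵥ g = 0 := by
    rw [Matrix.mulVec_eq_sum, ← hf, sum_filter]
    refine sum_congr rfl fun j _ => ?_
    by_cases h : x j = 0
    · simp [hg, h]
    · ext; simp [hg, h, Matrix.col, mul_comm]
  have hg0 : ∀ j, x j = 0 → g j = 0 := fun j h => by simp [hg, h]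
  have h1 := hx.objective_nonpos hAg fun j h => (hg0 j h).ge
  have h2 := hx.objective_nonpos (w := -g) (by rw [Matrix.mulVec_neg, hAg, neg_zero])
    fun j h => by simp [hg0 j h]
  have h3 : objective c (-g) = - objective c g := by simp [objective]
  obtain ⟨ε, hε, h⟩ := exists_pos_add_smul_nonneg hx.1.2 fun j h => (hg0 j h).ge
  have h4 : objective c (x + ε • g) = objective c x := by
    rw [objective_add_smul, show objective c g = 0 by linarith, mul_zero, add_zero]
  have h5 := huniq (x + ε • g)
    ⟨⟨by rw [Matrix.mulVec_add, Matrix.mulVec_smul, hAg, smul_zero, add_zero, hx.1.1], h⟩,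
      fun y hy => h4 ▸ hx.2 y hy⟩
  intro j hj
  have h6 : ε * g j = 0 := by simpa using congrFun h5 j
  have h7 := (mul_eq_zero.1 h6).resolve_left hε.ne'
  simpa [hg, (mem_filter.1 hj).2] using h7

/-- Linearly independent columns of a matrix of full row rank extend to a basis of columns. -/
theorem exists_basis_of_linearIndepOn (hA : (realMatrix A).rank = m) {S : Set (Fin n)}
    (hS : LinearIndepOn ℝ (realMatrix A).col S) :
    ∃ B : Fin m → Fin n, S ⊆ Set.range B ∧ (A.submatrix id B).det ≠ 0 := by
  classical
  -- A maximal independent set of columns spans the column space, so it has exactly `rank A = m`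
  -- elements.
  obtain ⟨T, -, hST, hspan, hT⟩ := exists_linearIndepOn_extension hS (Set.subset_univ S)
  have hcard : Fintype.card T = m := by
    rw [← hA, Matrix.rank_eq_finrank_span_cols]
    have h1 : Submodule.span ℝ (Set.range (realMatrix A).col) =
        Submodule.span ℝ (Set.range fun j : T => (realMatrix A).col j) := by
      rw [Set.image_univ] at hspan
      have h2 : (Set.range fun j : T => (realMatrix A).col j) = (realMatrix A).col '' T := by
        rw [Set.image_eq_range]
      rw [h2]
      exact le_antisymm (Submodule.span_le.2 hspan)
        (Submodule.span_mono (Set.image_subset_range _ _))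
    rw [h1]
    exact (finrank_span_eq_card hT).symm
  let e : Fin m ≃ T := (Fintype.equivFinOfCardEq hcard).symm
  refine ⟨fun i => e i, fun j hj => ⟨e.symm ⟨j, hST hj⟩, by simp⟩, ?_⟩
  have hli : LinearIndependent ℝ ((A.submatrix id fun i => (e i : Fin n)).map
      (fun a : ℤ => (a : ℝ))).col := hT.comp e e.injective
  have hu := (Matrix.isUnit_iff_isUnit_det _).1 (Matrix.linearIndependent_cols_iff_isUnit.1 hli)
  intro h0
  have h2 : ((A.submatrix id fun i => (e i : Fin n)).map (fun a : ℤ => (a : ℝ))).det = 0 := by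
    rw [← Int.cast_zero, ← h0]
    exact (Int.cast_det _).symm
  exact hu.ne_zero h2

/-- If all basic variables are positive at an optimal solution, then the reduced costs have the
optimal sign. -/
theorem LPOptimal.det_mul_reducedCost_nonpos {x : Fin n → ℝ} (hx : LPOptimal A c b x)
    (hd : (A.submatrix id B).det ≠ 0) (hB : ∀ i, x (B i) ≠ 0) (j : Fin n) :
    (A.submatrix id B).det * reducedCost A c B j ≤ 0 := by
  classical
  by_cases hj : j ∈ Set.range B
  · obtain ⟨k, rfl⟩ := hj
    simp [reducedCost_basis]
  have hinj := injective_of_det_submatrix_ne_zero hd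
  set d : ℝ := Int.cast (A.submatrix id B).det with hdd
  -- The simplex edge direction that raises the nonbasic variable `j`, scaled by `d ^ 2` to avoid
  -- division and stay nonnegative at `j` whatever the sign of `d`. Its basic entries may be
  -- negative, since `x` is nonzero there.
  set w : Fin n → ℝ := Pi.single j (d ^ 2) -
    Function.extend B (fun i => d * (tableau A B i j : ℝ)) 0 with hw
  have hwj : ∀ k ∉ Set.range B, w k = (Pi.single j (d ^ 2) : Fin n → ℝ) k := fun k hk => by
    rw [hw, Pi.sub_apply, Function.extend_apply' _ _ _ (by simpa using hk)]
    simp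
  have hA : realMatrix A *ᵥ w = 0 := by
    rw [hw, Matrix.mulVec_sub, mulVec_extend _ hinj]
    ext k
    have h := congrArg (Int.cast : ℤ → ℝ) (sum_mul_tableau A B k j)
    simp only [Int.cast_sum, Int.cast_mul] at h
    simp only [Pi.sub_apply, Matrix.mulVec_single, Matrix.mulVec, dotProduct,
      Matrix.submatrix_apply, id, Pi.zero_apply, realMatrix, Matrix.map_apply]
    have h2 : ∑ i, (A k (B i) : ℝ) * (d * tableau A B i j) = d * (d * A k j) := by
      rw [hdd, ← h, mul_sum]
      exact sum_congr rfl fun i _ => by ring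
    rw [h2]
    simp [Matrix.col]
    ring
  have hpos : ∀ k, x k = 0 → 0 ≤ w k := fun k hk => by
    rw [hwj k (by rintro ⟨i, rfl⟩; exact hB i hk)]
    by_cases hkj : k = j
    · subst hkj; simp [sq_nonneg]
    · simp [hkj]
  have h1 := hx.objective_nonpos hA hpos
  have h2 := det_mul_objective_of_mulVec_eq_zero hA c B
  rw [sum_eq_single j] at h2
  · rw [hwj j hj] at h2
    simp only [Pi.single_eq_same, ← hdd] at h2
    have hd0 : d ≠ 0 := by rw [hdd]; exact_mod_cast hd
    have h3 : d * reducedCost A c B j = objective c w := by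
      field_simp at h2 ⊢
      linarith
    rwa [h3]
  · intro k _ hkj
    by_cases hk : k ∈ Set.range B
    · obtain ⟨i, rfl⟩ := hk
      simp [reducedCost_basis]
    · simp [hwj k hk, hkj]
  · simp

/-! ### Proximity away from the facets -/

theorem IPFeasible.lpFeasible {z : Fin n → ℤ} (hz : IPFeasible A b z) :
    LPFeasible A b fun j => (z j : ℝ) := by
  refine ⟨?_, fun j => Int.cast_nonneg (hz.2 j)⟩
  ext i
  rw [← hz.1]
  simp [Matrix.mulVec, dotProduct, realMatrix]

/-- `det(A_B)` times a basic variable, in terms of the nonbasic ones. -/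
theorem sum_tableau_mul_eq [DecidableEq (Fin n)] (hB : Function.Injective B) (i : Fin m)
    (x : Fin n → ℝ) : ∑ j, (tableau A B i j : ℝ) * x j =
      (A.submatrix id B).det * x (B i) + ∑ j ∈ (univ.image B)ᶜ, (tableau A B i j : ℝ) * x j := by
  rw [sum_eq_sum_basis_add hB]
  simp [tableau_apply_basis]

theorem abs_sum_tableau_mul_le {H : ℝ} (hH : ∀ i j, |(tableau A B i j : ℝ)| ≤ H)
    (s : Finset (Fin n)) (i : Fin m) {x : Fin n → ℝ} (hx : ∀ j, 0 ≤ x j) :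
    |∑ j ∈ s, (tableau A B i j : ℝ) * x j| ≤ H * ∑ j ∈ s, x j := by
  rw [mul_sum]
  refine (abs_sum_le_sum_abs _ _).trans (sum_le_sum fun j _ => ?_)
  rw [abs_mul, abs_of_nonneg (hx j)]
  exact mul_le_mul_of_nonneg_right (hH i j) (hx j)

/-- `b` lies far from the facets of the cone spanned by the columns chosen by `B`. -/
def Deep (A : Matrix (Fin m) (Fin n) ℤ) (B : Fin m → Fin n) (D : ℕ) (b : Fin m → ℤ) : Prop :=
  ∀ i, (D : ℤ) < |((A.submatrix id B).adjugate *ᵥ b) i|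

/-- Every feasible integer point may be replaced by one which is at least as good and has small
nonbasic part. -/
theorem exists_ipFeasible_sum_lt {x : Fin n → ℝ} {H : ℝ} {D : ℕ} (hx : LPOptimal A c b x)
    (hd : (A.submatrix id B).det ≠ 0) (hB : ∀ i, x (B i) ≠ 0) (hN : ∀ j ∉ Set.range B, x j = 0)
    (hH : ∀ i j, |(tableau A B i j : ℝ)| ≤ H) (hdH : |((A.submatrix id B).det : ℝ)| ≤ H)
    (hD : H * H ≤ D) (hdeep : Deep A B D b) {y : Fin n → ℤ} (hy : IPFeasible A b y) :
    ∃ z, IPFeasible A b z ∧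
      (∑ j ∈ (univ.image B)ᶜ, z j < |(A.submatrix id B).det|) ∧
      objective c (fun j => (y j : ℝ)) ≤ objective c (fun j => (z j : ℝ)) := by
  classical
  have hinj := injective_of_det_submatrix_ne_zero hd
  have hH0 : 0 ≤ H := (abs_nonneg _).trans hdH
  -- The nonbasic part of `y`; the zeros on `B` force `u ≤ y'` to vanish there.
  set y' : Fin n → ℕ := fun j => if j ∈ Set.range B then 0 else (y j).toNat with hy'
  obtain ⟨u, hu, hus, v, hv⟩ := exists_le_sum_lt_natAbs_det (A.submatrix id B) hd A.col y'
  have hcomb : ∀ w : Fin n → ℕ, ∑ j, w j • A.col j = A *ᵥ fun j => (w j : ℤ) := fun w => by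
    rw [Matrix.mulVec_eq_sum]
    refine sum_congr rfl fun j _ => ?_
    ext k; simp [Matrix.col, mul_comm]
  rw [hcomb, hcomb] at hv
  have huB : ∀ i, u (B i) = 0 := fun i => by
    have := hu (B i)
    simpa [hy'] using this
  -- The basic coordinates absorb the removed nonbasic terms: `A_B v = A y' - A u`.
  set z : Fin n → ℤ := (fun j => (u j : ℤ)) + Function.extend B (fun i => y (B i) + v i) 0 with hz
  have hzN : ∀ j ∉ Set.range B, z j = u j := fun j hj => by
    rw [hz, Pi.add_apply, Function.extend_apply' _ _ _ (by simpa using hj)]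
    simp
  have hycomb : y = (fun j => (y' j : ℤ)) + Function.extend B (fun i => y (B i)) 0 := by
    ext j
    by_cases hj : j ∈ Set.range B
    · obtain ⟨i, rfl⟩ := hj
      simp [hy', hinj.extend_apply]
    · rw [Pi.add_apply, Function.extend_apply' _ _ _ (by simpa using hj)]
      simp only [hy', if_neg hj, Pi.zero_apply, add_zero]
      exact (Int.toNat_of_nonneg (hy.2 j)).symm
  have hAz : A *ᵥ z = b := by
    have h1 := hy.1
    rw [hycomb, Matrix.mulVec_add, mulVec_extend _ hinj] at h1
    rw [hz, Matrix.mulVec_add, mulVec_extend _ hinj,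
      show (fun i => y (B i) + v i) = (fun i => y (B i)) + v from rfl, Matrix.mulVec_add, hv, ← h1]
    abel
  have hsum : ∑ j ∈ (univ.image B)ᶜ, z j < |(A.submatrix id B).det| := by
    have h1 : ∑ j ∈ (univ.image B)ᶜ, z j = ∑ j ∈ (univ.image B)ᶜ, (u j : ℤ) :=
      sum_congr rfl fun j hj => hzN j (by simpa using hj)
    have h2 : ∑ j ∈ (univ.image B)ᶜ, u j ≤ ∑ j, u j :=
      sum_le_sum_of_subset (subset_univ _)
    rw [h1, Int.abs_eq_natAbs]
    exact_mod_cast h2.trans_lt hus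
  -- For a basic coordinate, `det(A_B) z_i` differs from `det(A_B) x_i` by at most `H * H ≤ D`, less
  -- than `|det(A_B) x_i|` by deepness. A negative `z_i` would put the two on opposite sides of
  -- zero.
  have hz0 : ∀ j, 0 ≤ z j := by
    intro j
    by_cases hj : j ∈ Set.range B
    swap
    · rw [hzN j hj]; positivity
    obtain ⟨i, rfl⟩ := hj
    have hzr : realMatrix A *ᵥ (fun j => (z j : ℝ)) = fun i => (b i : ℝ) := by
      rw [← hAz]; ext; simp [Matrix.mulVec, dotProduct, realMatrix]
    have e1 : ∑ j, (tableau A B i j : ℝ) * z j =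
        (((A.submatrix id B).adjugate *ᵥ b) i : ℤ) := by
      rw [sum_tableau_mul A B (fun j => (z j : ℝ)), hzr]
      simp [Matrix.mulVec, dotProduct]
    have e2 := sum_tableau_mul_of_feasible hx.1 B i
    rw [sum_tableau_mul_eq hinj] at e1 e2
    rw [sum_eq_zero fun j hj => by rw [hN j (by simpa using hj), mul_zero], add_zero] at e2
    have e3 : ∑ j ∈ (univ.image B)ᶜ, (tableau A B i j : ℝ) * z j =
        ∑ j ∈ (univ.image B)ᶜ, (tableau A B i j : ℝ) * u j :=
      sum_congr rfl fun j hj => by rw [hzN j (by simpa using hj)]; simp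
    have e4 := abs_sum_tableau_mul_le hH (univ.image B)ᶜ i (x := fun j => (u j : ℝ))
      fun j => Nat.cast_nonneg _
    have e5 : ∑ j ∈ (univ.image B)ᶜ, (u j : ℝ) ≤ H := by
      have h1 : ∑ j ∈ (univ.image B)ᶜ, u j ≤ ∑ j, u j :=
        sum_le_sum_of_subset (subset_univ _)
      refine le_trans ?_ hdH
      rw [← Int.cast_abs, Int.abs_eq_natAbs]
      exact_mod_cast (h1.trans_lt hus).le
    have e6 : |∑ j ∈ (univ.image B)ᶜ, (tableau A B i j : ℝ) * u j| ≤ D :=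
      e4.trans ((mul_le_mul_of_nonneg_left e5 hH0).trans hD)
    have e7 : (D : ℝ) < |((((A.submatrix id B).adjugate *ᵥ b) i : ℤ) : ℝ)| := by
      exact_mod_cast hdeep i
    have e8 := hx.1.2 (B i)
    rw [e3] at e1
    by_contra hneg
    have hneg' : (z (B i) : ℝ) < 0 := by exact_mod_cast not_le.1 hneg
    have e9 := abs_le.1 e6
    rcases lt_or_gt_of_ne hd with hlt | hlt
    · have hlt' : ((A.submatrix id B).det : ℝ) < 0 := by exact_mod_cast hlt
      have h1 := mul_nonneg_of_nonpos_of_nonpos hlt'.le hneg'.le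
      have h2 := mul_nonpos_of_nonpos_of_nonneg hlt'.le e8
      rw [← e2, abs_of_nonpos h2] at e7
      linarith
    · have hlt' : 0 < ((A.submatrix id B).det : ℝ) := by exact_mod_cast hlt
      have h1 := mul_nonpos_of_nonneg_of_nonpos hlt'.le hneg'.le
      have h2 := mul_nonneg hlt'.le e8
      rw [← e2, abs_of_nonneg h2] at e7
      linarith
  have hzf : IPFeasible A b z := ⟨hAz, hz0⟩
  refine ⟨z, hzf, hsum, ?_⟩
  set g : Fin n → ℝ := fun j => (z j : ℝ) - y j with hg
  have hgA : realMatrix A *ᵥ g = 0 := by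
    have : g = (fun j => (z j : ℝ)) - fun j => (y j : ℝ) := rfl
    rw [this, Matrix.mulVec_sub, hzf.lpFeasible.1, hy.lpFeasible.1, sub_self]
  have h1 := det_mul_objective_of_mulVec_eq_zero hgA c B
  have h2 : objective c g = objective c (fun j => (z j : ℝ)) - objective c (fun j => (y j : ℝ)) := by
    simp only [objective, hg, mul_sub, sum_sub_distrib]
  -- Multiplying by the determinant once more removes its sign. Each nonbasic term is then a product
  -- of two nonpositive factors, because `z j = u j ≤ y j`.
  have h3 : 0 ≤ ((A.submatrix id B).det : ℝ) * ∑ j, reducedCost A c B j * g j := by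
    rw [mul_sum]
    refine sum_nonneg fun j _ => ?_
    rw [← mul_assoc]
    by_cases hj : j ∈ Set.range B
    · obtain ⟨i, rfl⟩ := hj
      simp [reducedCost_basis]
    · refine mul_nonneg_of_nonpos_of_nonpos (hx.det_mul_reducedCost_nonpos hd hB j) ?_
      have h4 : (u j : ℤ) ≤ y j := by
        have := hu j
        simp only [hy', if_neg hj] at this
        have h5 := hy.2 j
        omega
      rw [← hzN j hj] at h4
      simp only [hg]
      exact sub_nonpos.2 (by exact_mod_cast h4)
  rw [← h1, ← mul_assoc] at h3
  have h4 : 0 < ((A.submatrix id B).det : ℝ) * (A.submatrix id B).det :=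
    mul_self_pos.2 (by exact_mod_cast hd)
  have h5 := nonneg_of_mul_nonneg_right h3 h4
  linarith

/-- Every integer solution with small nonbasic part is close to the vertex. -/
theorem sum_abs_sub_le {x : Fin n → ℝ} {H : ℝ} (hx : LPFeasible A b x)
    (hd : (A.submatrix id B).det ≠ 0) (hN : ∀ j ∉ Set.range B, x j = 0)
    (hH : ∀ i j, |(tableau A B i j : ℝ)| ≤ H) (hdH : |((A.submatrix id B).det : ℝ)| ≤ H)
    {z : Fin n → ℤ} (hz : IPFeasible A b z)
    (hs : ∑ j ∈ (univ.image B)ᶜ, z j < |(A.submatrix id B).det|) :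
    ∑ j, |x j - (z j : ℝ)| ≤ (m + 1) * H := by
  classical
  have hinj := injective_of_det_submatrix_ne_zero hd
  have hH0 : 0 ≤ H := (abs_nonneg _).trans hdH
  have hz0 : ∀ j, (0 : ℝ) ≤ z j := fun j => by exact_mod_cast hz.2 j
  have hd0 : 0 < |((A.submatrix id B).det : ℝ)| := abs_pos.2 (by exact_mod_cast hd)
  have hs' : ∑ j ∈ (univ.image B)ᶜ, (z j : ℝ) ≤ |((A.submatrix id B).det : ℝ)| := by
    exact_mod_cast hs.le
  rw [sum_eq_sum_basis_add hinj]
  have h1 : ∀ i, |x (B i) - z (B i)| ≤ H := fun i => by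
    have e1 := sum_tableau_mul_of_feasible hz.lpFeasible B i
    have e2 := sum_tableau_mul_of_feasible hx B i
    rw [sum_tableau_mul_eq hinj] at e1 e2
    rw [sum_eq_zero fun j hj => by rw [hN j (by simpa using hj), mul_zero], add_zero] at e2
    -- The right side is at most `H * |det A_B|`; cancelling the determinant leaves `H` and not `H *
    -- H`.
    have e3 : ((A.submatrix id B).det : ℝ) * (x (B i) - z (B i)) =
        ∑ j ∈ (univ.image B)ᶜ, (tableau A B i j : ℝ) * z j := by linarith
    have e4 := abs_sum_tableau_mul_le hH (univ.image B)ᶜ i hz0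
    rw [← e3, abs_mul] at e4
    have e5 := e4.trans (mul_le_mul_of_nonneg_left hs' hH0)
    rw [mul_comm] at e5
    exact le_of_mul_le_mul_right e5 hd0
  have h2 : ∑ j ∈ (univ.image B)ᶜ, |x j - z j| ≤ H := by
    refine le_trans (le_of_eq (sum_congr rfl fun j hj => ?_)) (hs'.trans hdH)
    rw [hN j (by simpa using hj), zero_sub, abs_neg, abs_of_nonneg (hz0 j)]
  have h3 : ∑ i, |x (B i) - z (B i)| ≤ m * H :=
    (sum_le_sum fun i _ => h1 i).trans (by simp)
  linarith

/-- Finiteness makes the objective attain a maximum on these points, which yields an IP optimum. -/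
theorem finite_setOf_ipFeasible_sum_lt (hd : (A.submatrix id B).det ≠ 0) {x : Fin n → ℝ}
    {H : ℝ} (hx : LPFeasible A b x) (hN : ∀ j ∉ Set.range B, x j = 0)
    (hH : ∀ i j, |(tableau A B i j : ℝ)| ≤ H) (hdH : |((A.submatrix id B).det : ℝ)| ≤ H) :
    {z | IPFeasible A b z ∧
      ∑ j ∈ (univ.image B)ᶜ, z j < |(A.submatrix id B).det|}.Finite := by
  refine (Set.finite_Icc (0 : Fin n → ℤ) fun j => ⌈x j + (m + 1) * H⌉).subset fun z hz =>
    ⟨hz.1.2, fun j => ?_⟩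
  have h1 := sum_abs_sub_le hx hd hN hH hdH hz.1 hz.2
  have h2 := (single_le_sum (fun j _ => abs_nonneg (x j - z j)) (mem_univ j)).trans h1
  have h3 : (z j : ℝ) ≤ x j + (m + 1) * H := by linarith [(abs_le.1 h2).1]
  exact_mod_cast h3.trans (Int.le_ceil _)

/-- Away from the facets of all simplicial cones spanned by columns of `A`, the integer program
has an optimal solution close to the vertex of the linear program. -/
theorem distFun_le_of_deep (hA : (realMatrix A).rank = m)
    (huniq : (∃ x, LPFeasible A b x) → ∃! x, LPOptimal A c b x) {D : ℕ}
    (hD : ((Real.sqrt m * maxAbsEntry A) ^ m) * ((Real.sqrt m * maxAbsEntry A) ^ m) ≤ (D : ℝ))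
    (hdeep : ∀ B : Fin m → Fin n, (A.submatrix id B).det ≠ 0 → Deep A B D b)
    (hf : ∃ z, IPFeasible A b z) :
    distFun A c b ≤ ENNReal.ofReal ((m + 1) * (Real.sqrt m * maxAbsEntry A) ^ m) := by
  classical
  obtain ⟨z₀, hz₀⟩ := hf
  have hex := huniq ⟨_, hz₀.lpFeasible⟩
  have hx : LPOptimal A c b (lpSolution A c b) := Classical.epsilon_spec hex.exists
  obtain ⟨B, hSB, hd⟩ := exists_basis_of_linearIndepOn hA
    (hx.linearIndepOn_col fun y hy => hex.unique hy hx)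
  set x := lpSolution A c b
  have hinj := injective_of_det_submatrix_ne_zero hd
  have hN : ∀ j ∉ Set.range B, x j = 0 := fun j hj => by
    by_contra h
    exact hj (hSB h)
  -- Nondegeneracy: `det(A_B) x_(B i)` is the `i`-th entry of `adj(A_B) b`, nonzero by deepness.
  have hB : ∀ i, x (B i) ≠ 0 := fun i h => by
    have e2 := sum_tableau_mul_of_feasible hx.1 B i
    rw [sum_tableau_mul_eq hinj, h, mul_zero,
      sum_eq_zero fun j hj => by rw [hN j (by simpa using hj), mul_zero], add_zero] at e2
    have h1 := hdeep B hd i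
    have h2 : ((A.submatrix id B).adjugate *ᵥ b) i = 0 := by exact_mod_cast e2.symm
    rw [h2, abs_zero] at h1
    omega
  have hH := abs_tableau_le A B
  have hdH := abs_det_submatrix_le A B
  have hred := fun y (hy : IPFeasible A b y) =>
    exists_ipFeasible_sum_lt hx hd hB hN hH hdH hD (hdeep B hd) hy
  obtain ⟨z₁, hz₁, hs₁, -⟩ := hred z₀ hz₀
  obtain ⟨z, hz, hmax⟩ := Set.exists_max_image _ (fun z => objective c fun j => (z j : ℝ))
    (finite_setOf_ipFeasible_sum_lt hd hx.1 hN hH hdH) ⟨z₁, hz₁, hs₁⟩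
  have hopt : IPOptimal A c b z := ⟨hz.1, fun y hy => by
    obtain ⟨w, hw, hws, hle⟩ := hred y hy
    exact hle.trans (hmax w ⟨hw, hws⟩)⟩
  exact (iInf₂_le z hopt).trans
    (ENNReal.ofReal_le_ofReal (sum_abs_sub_le hx.1 hd hN hH hdH hz.1 hz.2))

/-! ### Counting right-hand sides in cubes -/

/-- The integer points of the cube `[-t, t]^m`. -/
noncomputable def box (m t : ℕ) : Finset (Fin m → ℤ) :=
  Fintype.piFinset fun _ => Icc (-(t : ℤ)) t

theorem mem_box {t : ℕ} : b ∈ box m t ↔ ∀ i, |b i| ≤ (t : ℤ) := by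
  simp [box, abs_le]

theorem card_Icc_neg_self (t : ℕ) : #(Icc (-(t : ℤ)) t) = 2 * t + 1 := by
  rw [Int.card_Icc]; omega

theorem card_box (m t : ℕ) : #(box m t) = (2 * t + 1) ^ m := by
  rw [box, Fintype.card_piFinset]
  simp only [card_Icc_neg_self]
  simp

/-- A slab around a hyperplane contains few points of a large cube. -/
theorem card_slab_mul_le {r : Fin m → ℤ} (hr : r ≠ 0) (D t : ℕ) :
    #{b ∈ box m t | |r ⬝ᵥ b| ≤ (D : ℤ)} * (2 * t + 1) ≤ (2 * D + 1) * (2 * t + 1) ^ m := by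
  obtain ⟨k, hk⟩ := Function.ne_iff.1 hr
  rw [← card_box m t, ← card_Icc_neg_self D, ← card_Icc_neg_self t, ← card_product,
    ← card_product]
  -- Overwriting coordinate `k` by `s` loses only `b k`, which `r ⬝ᵥ b` recovers since `r k ≠ 0`.
  refine card_le_card_of_injOn (fun p => (r ⬝ᵥ p.1, Function.update p.1 k p.2)) ?_ ?_
  · rintro ⟨b, s⟩ hp
    simp only [coe_product, Set.mem_prod, mem_coe, mem_filter, mem_Icc, mem_box] at hp ⊢
    refine ⟨abs_le.1 hp.1.2, fun i => ?_⟩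
    by_cases hi : i = k
    · subst hi
      simpa using abs_le.2 hp.2
    · simpa [hi] using hp.1.1 i
  · rintro ⟨b, s⟩ - ⟨b', s'⟩ - h
    obtain ⟨h1, h2⟩ := Prod.mk.inj h
    have hs : s = s' := by simpa using congrFun h2 k
    have hl : ∀ l, l ≠ k → b l = b' l := fun l hl => by simpa [hl] using congrFun h2 l
    have h3 : r ⬝ᵥ (b - b') = 0 := by rw [dotProduct_sub, sub_eq_zero]; exact h1
    rw [dotProduct, sum_eq_single k (fun l _ hlk => by simp [hl l hlk]) (by simp)] at h3
    have h4 : b k = b' k := sub_eq_zero.1 ((mul_eq_zero.1 h3).resolve_left hk)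
    have hb : b = b' := by
      ext l
      by_cases hlk : l = k
      · rw [hlk, h4]
      · exact hl l hlk
    rw [hb, hs]

open Classical in
theorem exists_card_not_deep_mul_le (A : Matrix (Fin m) (Fin n) ℤ) (D : ℕ) :
    ∃ C : ℕ, ∀ t : ℕ,
      #{b ∈ box m t | ¬ ∀ B : Fin m → Fin n, (A.submatrix id B).det ≠ 0 → Deep A B D b} *
        (2 * t + 1) ≤ C * (2 * t + 1) ^ m := by
  let I : Finset ((Fin m → Fin n) × Fin m) := {p | (A.submatrix id p.1).det ≠ 0}
  refine ⟨#I * (2 * D + 1), fun t => ?_⟩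
  have hsub : ({b ∈ box m t |
      ¬ ∀ B : Fin m → Fin n, (A.submatrix id B).det ≠ 0 → Deep A B D b} : Finset (Fin m → ℤ)) ⊆
      I.biUnion fun p =>
        {b ∈ box m t | |(A.submatrix id p.1).adjugate p.2 ⬝ᵥ b| ≤ (D : ℤ)} := by
    intro b hb
    rw [mem_filter] at hb
    obtain ⟨hbt, hb⟩ := hb
    simp only [Deep] at hb
    push Not at hb
    obtain ⟨B, hd, i, hi⟩ := hb
    exact mem_biUnion.2 ⟨(B, i), by simpa [I] using hd, mem_filter.2 ⟨hbt, hi⟩⟩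
  calc _ ≤ (∑ p ∈ I, #{b ∈ box m t | |(A.submatrix id p.1).adjugate p.2 ⬝ᵥ b| ≤ (D : ℤ)}) *
        (2 * t + 1) := Nat.mul_le_mul_right _ ((card_le_card hsub).trans card_biUnion_le)
    _ ≤ ∑ _p ∈ I, (2 * D + 1) * (2 * t + 1) ^ m := by
        rw [sum_mul]
        refine sum_le_sum fun p hp => card_slab_mul_le (fun h0 => ?_) D t
        have hd : (A.submatrix id p.1).det ≠ 0 := by simpa [I] using hp
        -- The adjugate row is nonzero: its product with the matching column of `A_B` is `det A_B`.
        have h1 := tableau_apply_basis A p.1 p.2 p.2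
        rw [if_pos rfl] at h1
        refine hd (h1 ▸ ?_)
        rw [tableau, Matrix.mul_apply]
        exact sum_eq_zero fun k _ => by rw [h0]; simp
    _ = _ := by rw [sum_const, smul_eq_mul, mul_assoc]

open Classical in
/-- The right-hand sides for which the integer program is feasible have positive density. -/
theorem pow_le_card_feasible_mul (hd : (A.submatrix id B).det ≠ 0) (t : ℕ) :
    (t + 1) ^ m ≤
      #{b ∈ box m t | ∃ z, IPFeasible A b z} * (m * maxAbsEntry A + 1) ^ m := by
  -- With this `M`, every `v` in `[0, t / M]^m` has `A_B v` in the cube of radius `t`; the `+ 1`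
  -- keeps `M` positive.
  set M := m * maxAbsEntry A + 1 with hM
  have hinj := injective_of_det_submatrix_ne_zero hd
  have h1 : (t / M + 1) ^ m ≤ #{b ∈ box m t | ∃ z, IPFeasible A b z} := by
    have hc : #(Fintype.piFinset fun _ : Fin m => range (t / M + 1)) = (t / M + 1) ^ m := by simp
    rw [← hc]
    refine card_le_card_of_injOn
      (fun v => A.submatrix id B *ᵥ fun i => (v i : ℤ)) (fun v hv => ?_) ?_
    · have hv' : ∀ i, v i ≤ t / M := fun i => by
        have := Fintype.mem_piFinset.1 (mem_coe.1 hv) i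
        rw [mem_range] at this
        omega
      refine mem_coe.2 (mem_filter.2 ⟨mem_box.2 fun k => ?_, ?_⟩)
      · have h2 : |(A.submatrix id B *ᵥ fun i => (v i : ℤ)) k| ≤
            ∑ _i : Fin m, (maxAbsEntry A * (t / M : ℕ) : ℤ) := by
          rw [Matrix.mulVec, dotProduct]
          refine (abs_sum_le_sum_abs (G := ℤ) _ _).trans (sum_le_sum fun i _ => ?_)
          rw [abs_mul, Int.abs_eq_natAbs, Nat.abs_cast]
          have h3 : (A k (B i)).natAbs ≤ maxAbsEntry A :=
            le_sup (f := fun p : Fin m × Fin n => (A p.1 p.2).natAbs) (mem_univ (k, B i))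
          exact_mod_cast Nat.mul_le_mul h3 (hv' i)
        refine h2.trans ?_
        have h4 : m * (maxAbsEntry A * (t / M)) ≤ t := by
          calc _ = (m * maxAbsEntry A) * (t / M) := by ring
            _ ≤ M * (t / M) := Nat.mul_le_mul_right _ (by omega)
            _ ≤ t := Nat.mul_div_le t M
        rw [sum_const, card_univ, Fintype.card_fin, nsmul_eq_mul]
        exact_mod_cast h4
      · refine ⟨Function.extend B (fun i => (v i : ℤ)) 0, mulVec_extend A hinj _, fun j => ?_⟩
        by_cases hj : j ∈ Set.range B
        · obtain ⟨i, rfl⟩ := hj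
          rw [hinj.extend_apply]; positivity
        · rw [Function.extend_apply' _ _ _ (by simpa using hj)]; rfl
    · intro v _ w _ h
      have h2 := Matrix.mulVec_injective_of_det_ne_zero hd h
      ext i
      exact_mod_cast congrFun h2 i
  calc (t + 1) ^ m ≤ ((t / M + 1) * M) ^ m := by
        refine Nat.pow_le_pow_left ?_ m
        have h2 := Nat.div_add_mod t M
        have h3 := Nat.mod_lt t (show 0 < M by omega)
        rw [add_mul, one_mul, mul_comm]
        omega
    _ = (t / M + 1) ^ m * M ^ m := mul_pow _ _ _
    _ ≤ _ := Nat.mul_le_mul_right _ h1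

/-! ### Density one -/

/-- An event whose complement is negligible in a set of positive density has density one. -/
theorem lowerDensity_eq_one_of_card_bound (f : (Fin m → ℤ) → ℝ≥0∞) (E : Set (Fin m → ℤ))
    (F G : ℕ → Finset (Fin m → ℤ)) (K : ℕ) (hG : ∀ t, #(G t) * (t + 1) ≤ K * #(F t))
    (hF : ∀ t, 0 < #(F t)) (hFbox : ∀ t, F t ⊆ box m t)
    (hgood : ∀ t, ∀ b ∈ F t, b ∉ G t → f b < ∞)
    (hbad : ∀ t, ∀ b ∈ box m t, f b < ∞ → b ∉ E → b ∈ G t) :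
    lowerDensity f E = 1 := by
  classical
  have hden : ∀ t : ℕ, Set.ncard {b : Fin m → ℤ | (∀ i, |b i| ≤ (t : ℤ)) ∧ f b < ∞} =
      #{b ∈ box m t | f b < ∞} := fun t => by
    rw [← Set.ncard_coe_finset]; congr 1; ext; simp [mem_box]
  have hnum : ∀ t : ℕ, Set.ncard {b : Fin m → ℤ | b ∈ E ∧ (∀ i, |b i| ≤ (t : ℤ)) ∧ f b < ∞} =
      #{b ∈ box m t | f b < ∞ ∧ b ∈ E} := fun t => by
    rw [← Set.ncard_coe_finset]; congr 1; ext; simp [mem_box]; tauto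
  have hle : ∀ t, boxDensity f E t ≤ 1 := fun t => by
    rw [boxDensity, hden, hnum]
    refine div_le_one_of_le₀ ?_ (Nat.cast_nonneg _)
    exact_mod_cast card_le_card fun b => by simp +contextual
  -- For `t ≥ 2K` the set `G t` has at most half the size of `F t`, so the denominator is at least
  -- `#(F t) / 2`. This is the source of the factor 2.
  have hge : ∀ᶠ t : ℕ in Filter.atTop, 1 - 2 * (K : ℝ) / ((t : ℝ) + 1) ≤ boxDensity f E t := by
    filter_upwards [Filter.eventually_ge_atTop (2 * K)] with t ht
    rw [boxDensity, hden, hnum]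
    set T := #{b ∈ box m t | f b < ∞} with hT
    set N := #{b ∈ box m t | f b < ∞ ∧ b ∈ E} with hN
    have h1 : T ≤ N + #(G t) := by
      refine (card_le_card fun b hb => ?_).trans (card_union_le _ _)
      rw [mem_filter] at hb
      by_cases hbE : b ∈ E
      · exact mem_union_left _ (mem_filter.2 ⟨hb.1, hb.2, hbE⟩)
      · exact mem_union_right _ (hbad t b hb.1 hb.2 hbE)
    have h2 : #(F t) ≤ T + #(G t) := by
      refine (card_le_card fun b hb => ?_).trans (card_union_le _ _)
      by_cases hbG : b ∈ G t
      · exact mem_union_right _ hbG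
      · exact mem_union_left _ (mem_filter.2 ⟨hFbox t hb, hgood t b hb hbG⟩)
    have h3 := hG t
    have h4 := hF t
    have h1' : (T : ℝ) ≤ N + #(G t) := by exact_mod_cast h1
    have h2' : (#(F t) : ℝ) ≤ T + #(G t) := by exact_mod_cast h2
    have h3' : (#(G t) : ℝ) * (t + 1) ≤ K * #(F t) := by exact_mod_cast h3
    have h4' : (0 : ℝ) < #(F t) := by exact_mod_cast h4
    have ht' : 2 * (K : ℝ) ≤ t := by exact_mod_cast ht
    have ht1 : (0 : ℝ) < t + 1 := by positivity
    have h5 : 2 * (#(G t) : ℝ) ≤ #(F t) := by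
      refine le_of_mul_le_mul_right ?_ ht1
      nlinarith
    have hT0 : (0 : ℝ) < T := by linarith
    rw [le_div_iff₀ hT0, sub_mul, one_mul]
    have h6 : (#(G t) : ℝ) ≤ 2 * K / (t + 1) * T := by
      rw [div_mul_eq_mul_div, le_div_iff₀ ht1]
      have : (K : ℝ) * #(F t) ≤ K * (2 * T) :=
        mul_le_mul_of_nonneg_left (by linarith) (Nat.cast_nonneg _)
      linarith
    linarith
  have hlim : Filter.Tendsto (fun t : ℕ => 1 - 2 * (K : ℝ) / ((t : ℝ) + 1)) Filter.atTop
      (nhds 1) := by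
    have h := (tendsto_one_div_add_atTop_nhds_zero_nat (𝕜 := ℝ)).const_mul (2 * (K : ℝ))
    simpa [div_eq_mul_inv] using h.const_sub 1
  exact (tendsto_of_tendsto_of_tendsto_of_le_of_le' hlim tendsto_const_nhds hge
    (Filter.Eventually.of_forall hle)).liminf_eq

open Classical in
/-- The proximity bound `(m + 1) (√m ‖A‖_∞)^m` holds for almost all right-hand sides. -/
theorem prLe_distFun_eq_one (hA : (realMatrix A).rank = m)
    (huniq : ∀ b : Fin m → ℤ, (∃ x, LPFeasible A b x) → ∃! x, LPOptimal A c b x) :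
    prLe (distFun A c) ((m + 1) * (Real.sqrt m * maxAbsEntry A) ^ m) = 1 := by
  obtain ⟨D, hD⟩ := exists_nat_ge
    (((Real.sqrt m * maxAbsEntry A) ^ m) * ((Real.sqrt m * maxAbsEntry A) ^ m))
  obtain ⟨C, hC⟩ := exists_card_not_deep_mul_le A D
  obtain ⟨B, -, hd⟩ := exists_basis_of_linearIndepOn hA (linearIndepOn_empty ℝ _)
  set M := (m * maxAbsEntry A + 1) ^ m
  have hfeas := fun t => pow_le_card_feasible_mul hd t
  have key : ∀ b, (∃ z, IPFeasible A b z) →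
      (∀ B : Fin m → Fin n, (A.submatrix id B).det ≠ 0 → Deep A B D b) →
      distFun A c b ≤ ENNReal.ofReal ((m + 1) * (Real.sqrt m * maxAbsEntry A) ^ m) :=
    fun b hf hdeep => distFun_le_of_deep hA (huniq b) hD hdeep hf
  refine lowerDensity_eq_one_of_card_bound _ _
    (fun t => {b ∈ box m t | ∃ z, IPFeasible A b z})
    (fun t => {b ∈ box m t |
      ¬ ∀ B : Fin m → Fin n, (A.submatrix id B).det ≠ 0 → Deep A B D b})
    -- The factor `2 ^ m` comes from `2t + 1 ≤ 2(t + 1)`, and `M` from the lower bound on the number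
    -- of feasible `b`.
    (C * 2 ^ m * M) (fun t => ?_) (fun t => ?_) (fun t => filter_subset _ _) ?_ ?_
  · refine (Nat.mul_le_mul_left _ (by omega : t + 1 ≤ 2 * t + 1)).trans ((hC t).trans ?_)
    calc C * (2 * t + 1) ^ m ≤ C * (2 * (t + 1)) ^ m :=
          Nat.mul_le_mul_left _ (Nat.pow_le_pow_left (by omega) m)
      _ = C * 2 ^ m * (t + 1) ^ m := by rw [mul_pow, mul_assoc]
      _ ≤ C * 2 ^ m * (#{b ∈ box m t | ∃ z, IPFeasible A b z} * M) :=
          Nat.mul_le_mul_left _ (hfeas t)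
      _ = _ := by ring
  · exact Nat.pos_of_mul_pos_right ((Nat.pow_pos (Nat.succ_pos t)).trans_le (hfeas t))
  · intro t b hb hbG
    rw [mem_filter] at hb hbG
    exact (key b hb.2 (by tauto)).trans_lt ENNReal.ofReal_lt_top
  · intro t b hb hfin hbE
    refine mem_filter.2 ⟨hb, fun hdeep => hbE (key b ?_ hdeep)⟩
    -- An infimum below `∞` is not over an empty family, so an IP optimum exists.
    obtain ⟨z, hz⟩ := iInf_lt_iff.1 hfin
    obtain ⟨hz, -⟩ := iInf_lt_iff.1 hz
    exact ⟨z, hz.1⟩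

end ParametricIP

theorem mainTheorem4 (m n : ℕ) (A : Matrix (Fin m) (Fin n) ℤ) (c : Fin n → ℚ)
    (hA : (ParametricIP.realMatrix A).rank = m)
    (hc : ∀ x : Fin n → ℝ, (∀ j, 0 ≤ x j) → ParametricIP.realMatrix A *ᵥ x = 0 →
      ParametricIP.objective c x ≤ 0)
    (huniq : ∀ b : Fin m → ℤ, (∃ x, ParametricIP.LPFeasible A b x) →
      ∃! x, ParametricIP.LPOptimal A c b x) :
    ParametricIP.prLe (ParametricIP.distFun A c)
      (((m : ℝ) + 1) * (Real.sqrt (m : ℝ) * (ParametricIP.maxAbsEntry A : ℝ)) ^ m) = 1 :=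
  ParametricIP.prLe_distFun_eq_one hA huniq
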